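/- **Theorem 2.1.** Let $\Omega\subset\mathbb{R}^2$ be a bounded open set such that every connected component $\mathcal{C}$ of $\partial\Omega$ is a simple closed curve of class $C^2$ with Lipschitz curvature (e.g. of class $C^3$), parametrized by arc length by an $L_{\mathcal{C}}$-periodic map $\gamma$, $L_{\mathcal{C}}$ being the length of $\mathcal{C}$. Let $N(s)$ be the unit normal at $\gamma(s)$ obtained by rotating $\gamma'(s)$ by $+\pi/2$, let $\gamma$ be oriented so that $N$ points into $\Omega$, and let $\kappa$ be the signed curvature, $\gamma''=\kappa N$. Let $\delta_{\mathcal{C}}>0$ be such that $$\psi(n,s)=\gamma(s)+nN(s)$$ is a diffeomorphism from $(0,\delta_{\mathcal{C}})\times\mathbb{R}/L_{\mathcal{C}}\mathbb{Z}$ onto $\{q\in\Omega : d(q,\mathcal{C})<\delta_{\mathcal{C}}\}$, with $d(\psi(n,s),\mathcal{C})=n$. Let $b:\Omega\to\mathbb{R}$ be locally Lipschitz, let $\mathbf{A}=(A_1,A_2)$ be a $C^1$ vector potential on $\Omega$, $\partial_1A_2-\partial_2A_1=b$, and let $\mathcal{H}(q,p)=\frac12\|p-\mathbf{A}(q)\|^2$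 for $(q,p)\in\Omega\times\mathbb{R}^2$. Near $\mathcal{C}$ put $B(n,s)=-b(\psi(n,s))(1-n\kappa(s))$. Assume that, for every connected component $\mathcal{C}$ of $\partial\Omega$, $$\lim_{n\to0^+}\left|\int_n^{\delta_{\mathcal{C}}}\int_0^{L_{\mathcal{C}}}B(\eta,\xi)\,d\xi\,d\eta\right|=+\infty$$ and that there is $M_{\mathcal{C}}\ge0$ such that, for all $(n,s)\in(0,\delta_{\mathcal{C}})\times\mathbb{R}/L_{\mathcal{C}}\mathbb{Z}$, $$\left|B(n,s)-\frac1{L_{\mathcal{C}}}\int_0^{L_{\mathcal{C}}}B(n,\xi)\,d\xi\right|\le M_{\mathcal{C}}.$$ Then the magnetic Hamiltonian dynamics $\dot q=\partial_p\mathcal{H}(q,p)$, $\dot p=-\partial_q\mathcal{H}(q,p)$ is complete: for every $(q_0,p_0)\in\Omega\times\mathbb{R}^2$ there is exactly one solution $(q,p):\mathbb{R}\to\Omega\times\mathbb{R}^2$ with $(q,p)(0)=(q_0,p_0)$; and no solution reaches $\partial\Omega$ in finite time: if $0<T<\infty$ and $(q,p):[0,T)\to\Omega\times\mathbb{R}^2$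 is a solution, then $q(t)$ does not converge to a point of $\partial\Omega$ as $t\to T^-$. -/

import Mathlib

open Set Filter Topology

noncomputable section

namespace MagneticConfinement

/-- The Euclidean plane. -/
abbrev Plane : Type := EuclideanSpace ℝ (Fin 2)

/-- Rotation by the angle `+π/2`. -/
def rot (v : Plane) : Plane := !₂[-(v 1), v 0]

/-! ### Magnetic Hamiltonian dynamics -/

/-- `A = A₁ dq₁ + A₂ dq₂` is a `C¹` vector potential on `Ω` of the magnetic field
`b dq₁ ∧ dq₂`, that is, `∂₁ A₂ - ∂₂ A₁ = b` on `Ω`. -/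
def IsVectorPotential (Ω : Set Plane) (A : Plane → Plane) (b : Plane → ℝ) : Prop :=
  ContDiffOn ℝ 1 A Ω ∧
    ∀ q ∈ Ω, (fderiv ℝ A q (EuclideanSpace.single 0 1)) 1
      - (fderiv ℝ A q (EuclideanSpace.single 1 1)) 0 = b q

/-- The magnetic Hamiltonian `‖p - A(q)‖² / 2`. -/
def hamiltonian (A : Plane → Plane) (q p : Plane) : ℝ := ‖p - A q‖ ^ 2 / 2

/-- `t ↦ z t = (q t, p t)` solves Hamilton's equations `q' = ∂ₚ H`, `p' = -∂_q H` on the set of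
times `I`, with `q t ∈ Ω` for `t ∈ I`. -/
def IsTrajectoryOn (Ω : Set Plane) (A : Plane → Plane) (I : Set ℝ) (z : ℝ → Plane × Plane) :
    Prop :=
  ∀ t ∈ I, (z t).1 ∈ Ω ∧
    HasDerivWithinAt (fun τ => (z τ).1)
      (gradient (fun p => hamiltonian A (z t).1 p) (z t).2) I t ∧
    HasDerivWithinAt (fun τ => (z τ).2)
      (-gradient (fun q => hamiltonian A q (z t).2) (z t).1) I t

/-! ### Boundary curves and tubular coordinates -/

/-- `C` is a connected component of the boundary of `Ω`. -/
def IsBoundaryComponent (Ω C : Set Plane) : Prop :=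
  ∃ x ∈ frontier Ω, C = connectedComponentIn (frontier Ω) x

/-- `γ`, seen as a map on `ℝ / Lℤ`, is a parametrization by arc length of the simple closed curve
`C`. It is of class `C²` and its second derivative is Lipschitz (equivalently, the curvature is
Lipschitz), which holds in particular for every `C³` curve. -/
structure IsArcLengthParam (C : Set Plane) (γ : ℝ → Plane) (L : ℝ) : Prop where
  length_pos : 0 < L
  periodic : Function.Periodic γ L
  contDiff : ContDiff ℝ 2 γ
  lipschitz : ∃ K, LipschitzWith K (deriv (deriv γ))
  unit_speed : ∀ s, ‖deriv γ s‖ = 1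
  injOn : InjOn γ (Ico 0 L)
  range_eq : range γ = C

/-- The unit normal to the left of `γ`; `IsTubularWidth` makes it point into `Ω`. -/
def normal (γ : ℝ → Plane) (s : ℝ) : Plane := rot (deriv γ s)

/-- The signed curvature, `γ'' = κ N`. -/
def curvature (γ : ℝ → Plane) (s : ℝ) : ℝ := inner ℝ (deriv (deriv γ) s) (normal γ s)

/-- The tubular map `ψ(n, s) = γ(s) + n N(s)`. -/
def tubularMap (γ : ℝ → Plane) (x : ℝ × ℝ) : Plane := γ x.2 + x.1 • normal γ x.2

/-- The points of `Ω` at distance less than `δ` from `C`. -/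
def collar (Ω C : Set Plane) (δ : ℝ) : Set Plane := {q ∈ Ω | Metric.infDist q C < δ}

/-- The tubular map is a diffeomorphism from `(0, δ) × ℝ / Lℤ` onto the `δ`-collar of `C` in `Ω`,
with `n` the distance to `C`: the sets `n < δ'` correspond to the `δ'`-collars. Here `[0, L)`
represents `ℝ / Lℤ`, and `1 - n κ(s)` is the Jacobian determinant of the `C¹` map `ψ`. -/
structure IsTubularWidth (Ω C : Set Plane) (γ : ℝ → Plane) (L δ : ℝ) : Prop where
  pos : 0 < δ
  bijOn : ∀ δ' ∈ Ioc 0 δ, BijOn (tubularMap γ) (Ioo 0 δ' ×ˢ Ico 0 L) (collar Ω C δ')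
  jacobian_ne_zero : ∀ n ∈ Ioo 0 δ, ∀ s, 1 - n * curvature γ s ≠ 0

/-- The magnetic field in tubular coordinates, `B(n, s) = -b(ψ(n, s)) (1 - n κ(s))`. -/
def tubularField (b : Plane → ℝ) (γ : ℝ → Plane) (n s : ℝ) : ℝ :=
  -(b (tubularMap γ (n, s))) * (1 - n * curvature γ s)

end MagneticConfinement

end

/-!
A charge moves at constant speed, so its motion can only fail to exist for all times by reaching the
boundary. In tubular coordinates `(n, s)` near a boundary curve, let `Φ(n)` be the flux of the mean
field between the level lines `n` and `δ`. Along a motion with velocity `v`, the tangential momentum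
`(1 - n κ(s)) ⟨v, γ'(s)⟩` varies like `Φ(n)` up to a bounded error: the field differs from its mean
by at most `M`, and `κ` is Lipschitz. Hence `Φ(n) - (1 - n κ(s)) ⟨v, γ'(s)⟩` is Lipschitz in time,
and as the momentum is at most a multiple of the speed, `Φ(n)` stays bounded in finite time. But
`Φ(n)` is unbounded as `n → 0`, so the boundary is out of reach. Negative times are obtained by
reversing the motion, which replaces `b` by `-b`.
-/

namespace MagneticConfinement

/-! ### Lipschitz estimates -/

theorem eventually_norm_sub_le_of_hasDerivAt {F : Type*} [NormedAddCommGroup F] [NormedSpace ℝ F]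
    {f : ℝ → F} {f' : F} {t r : ℝ}
    (hf : HasDerivAt f f' t) (hr : ‖f'‖ < r) : ∀ᶠ τ in 𝓝 t, ‖f τ - f t‖ ≤ r * |τ - t| := by
  have hslope := hf.hasDerivWithinAt (s := univ).limsup_norm_slope_le hr
  rw [nhdsWithin_univ] at hslope
  filter_upwards [hslope] with τ hτ
  rcases eq_or_ne τ t with rfl | hne
  · simp
  · rw [← div_eq_inv_mul, div_lt_iff₀ (norm_pos_iff.2 (sub_ne_zero.2 hne))] at hτ
    exact hτ.le

theorem norm_sub_le_of_eventually_norm_sub_le {F : Type*} [SeminormedAddCommGroup F] {f : ℝ → F}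
    {K a b : ℝ} (hab : a ≤ b)
    (hf : ∀ t ∈ Icc a b, ∀ᶠ τ in 𝓝 t, ‖f τ - f t‖ ≤ K * |τ - t|) :
    ‖f b - f a‖ ≤ K * (b - a) := by
  have hcont : ∀ t ∈ Icc a b, ContinuousAt f t := fun t ht => by
    refine tendsto_iff_norm_sub_tendsto_zero.2
      (squeeze_zero' (Eventually.of_forall fun _ => norm_nonneg _) (hf t ht) ?_)
    exact Continuous.tendsto' (by fun_prop) t 0 (by simp)
  have hline (t : ℝ) : HasDerivAt (fun t => K * (t - a)) K t := by
    simpa using ((hasDerivAt_id t).sub_const a).const_mul K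
  refine image_le_of_liminf_slope_right_le_deriv_boundary
    (f := fun t => ‖f t - f a‖) (B := fun t => K * (t - a)) (B' := fun _ => K)
    (fun t ht => ((hcont t ht).sub continuousAt_const).norm.continuousWithinAt) (by simp)
    (fun t _ => (hline t).continuousAt.continuousWithinAt)
    (fun t _ => (hline t).hasDerivWithinAt) (fun t ht r hr => ?_) ⟨hab, le_rfl⟩
  refine Eventually.frequently ?_
  filter_upwards [nhdsWithin_le_nhds (hf t (Ico_subset_Icc_self ht)), self_mem_nhdsWithin]
    with τ hτ (hlt : t < τ)
  have hpos : 0 < τ - t := sub_pos.2 hlt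
  rw [abs_of_pos hpos] at hτ
  rw [slope_def_field, div_lt_iff₀ hpos]
  calc ‖f τ - f a‖ - ‖f t - f a‖ ≤ ‖f τ - f t‖ := by
        simpa only [sub_sub_sub_cancel_right] using norm_sub_norm_le (f τ - f a) (f t - f a)
    _ ≤ K * (τ - t) := hτ
    _ < r * (τ - t) := by gcongr

theorem lipschitzOnWith_of_eventually_norm_sub_le {F : Type*} [SeminormedAddCommGroup F]
    {f : ℝ → F} {K : ℝ} {s : Set ℝ} (hs : s.OrdConnected)
    (hf : ∀ t ∈ s, ∀ᶠ τ in 𝓝 t, ‖f τ - f t‖ ≤ K * |τ - t|) :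
    LipschitzOnWith K.toNNReal f s := by
  have hle {a b : ℝ} (ha : a ∈ s) (hb : b ∈ s) (hab : a ≤ b) : dist (f b) (f a) ≤ K * dist b a := by
    rw [dist_eq_norm, Real.dist_eq, abs_of_nonneg (sub_nonneg.2 hab)]
    exact norm_sub_le_of_eventually_norm_sub_le hab fun t ht => hf t (hs.out ha hb ht)
  refine LipschitzOnWith.of_dist_le' fun a ha b hb => ?_
  rcases le_total a b with hab | hba
  · rw [dist_comm, dist_comm a]
    exact hle ha hb hab
  · exact hle hb ha hba

/-- Integration of `u' - μ g'` by parts when `μ` is only Lipschitz. -/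
theorem lipschitzOnWith_sub_mul {u u' g g' μ : ℝ → ℝ} {s : Set ℝ} {c D K : ℝ}
    (hs : s.OrdConnected) (hu : ∀ t ∈ s, HasDerivAt u (u' t) t)
    (hg : ∀ t ∈ s, HasDerivAt g (g' t) t) (hD : ∀ t ∈ s, |u' t - μ t * g' t| < D)
    (hc : ∀ t ∈ s, |g t| < c) (hμ : ∀ t ∈ s, ∀ᶠ τ in 𝓝 t, |μ τ - μ t| ≤ K * |τ - t|) :
    LipschitzOnWith (D + K * c).toNNReal (fun t => u t - μ t * g t) s := by
  refine lipschitzOnWith_of_eventually_norm_sub_le hs fun t ht => ?_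
  have hfrozen := eventually_norm_sub_le_of_hasDerivAt
    ((hu t ht).sub ((hg t ht).const_mul (μ t))) (hD t ht)
  filter_upwards [hfrozen, hμ t ht, (hg t ht).continuousAt.abs.eventually_lt_const (hc t ht)]
    with τ hfτ hμτ hgτ
  calc |(u τ - μ τ * g τ) - (u t - μ t * g t)|
      = |((u τ - μ t * g τ) - (u t - μ t * g t)) - (μ τ - μ t) * g τ| := by ring_nf
    _ ≤ |(u τ - μ t * g τ) - (u t - μ t * g t)| + |μ τ - μ t| * |g τ| := by
        rw [← abs_mul]; exact abs_sub _ _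
    _ ≤ D * |τ - t| + K * |τ - t| * c :=
        add_le_add hfτ (mul_le_mul hμτ hgτ.le (abs_nonneg _) ((abs_nonneg _).trans hμτ))
    _ = (D + K * c) * |τ - t| := by ring

theorem exists_lipschitzOnWith_inner {X E : Type*} [PseudoMetricSpace X]
    [SeminormedAddCommGroup E] [InnerProductSpace ℝ E] {f g : X → E} {s : Set X} {Kf Kg : NNReal}
    (hf : LipschitzOnWith Kf f s) (hg : LipschitzOnWith Kg g s)
    (hfb : Bornology.IsBounded (f '' s)) (hgb : Bornology.IsBounded (g '' s)) :
    ∃ K, LipschitzOnWith K (fun x => inner ℝ (f x) (g x)) s := by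
  obtain ⟨Cf, hCf0, hCf⟩ := hfb.exists_pos_norm_le
  obtain ⟨Cg, hCg⟩ := hgb.exists_norm_le
  refine ⟨_, LipschitzOnWith.of_dist_le' (K := Kf * Cg + Cf * Kg) fun x hx y hy => ?_⟩
  calc dist (inner ℝ (f x) (g x)) (inner ℝ (f y) (g y))
      = |inner ℝ (f x - f y) (g x) + inner ℝ (f y) (g x - g y)| := by
        rw [inner_sub_left, inner_sub_right, sub_add_sub_cancel, Real.dist_eq]
    _ ≤ ‖f x - f y‖ * ‖g x‖ + ‖f y‖ * ‖g x - g y‖ :=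
        (abs_add_le _ _).trans
          (add_le_add (abs_real_inner_le_norm _ _) (abs_real_inner_le_norm _ _))
    _ ≤ Kf * dist x y * Cg + Cf * (Kg * dist x y) := by
        gcongr
        · exact dist_eq_norm (f x) (f y) ▸ hf.dist_le_mul x hx y hy
        · exact hCg _ (mem_image_of_mem g hx)
        · exact hCf _ (mem_image_of_mem f hy)
        · exact dist_eq_norm (g x) (g y) ▸ hg.dist_le_mul x hx y hy
    _ = (Kf * Cg + Cf * Kg) * dist x y := by ring

theorem periodic_deriv {F : Type*} [NormedAddCommGroup F] [NormedSpace ℝ F] {f : ℝ → F} {L : ℝ}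
    (hf : Function.Periodic f L) : Function.Periodic (deriv f) L := fun s => by
  rw [← deriv_comp_add_const, funext hf]

/-! ### Integral curves of autonomous vector fields -/

section ODE

variable {E : Type*} [NormedAddCommGroup E]

theorem exists_isPicardLindelof_of_lipschitzOnWith {f : E → E} {K : NNReal} {S : Set E} {x : E}
    (hf : LipschitzOnWith K f S) (hS : S ∈ 𝓝 x) :
    ∃ (ε : ℝ) (hε : 0 < ε) (a r M : NNReal), 0 < r ∧
      IsPicardLindelof (fun _ => f) (tmin := -ε) (tmax := ε) ⟨0, by simp [hε.le]⟩ x a r M K := by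
  obtain ⟨a, ha, haS⟩ := Metric.nhds_basis_closedBall.mem_iff.1 hS
  lift a to NNReal using ha.le
  set M : NNReal := ‖f x‖₊ + K * a + 1 with hM
  have ha' : 0 < a := ha
  have hbound : ∀ y ∈ Metric.closedBall x (a : ℝ), ‖f y‖ ≤ M := fun y hy => by
    calc ‖f y‖ ≤ ‖f x‖ + ‖f y - f x‖ := by simpa using norm_add_le (f x) (f y - f x)
      _ ≤ ‖f x‖ + K * ‖y - x‖ := by
        gcongr; exact hf.norm_sub_le (haS hy) (mem_of_mem_nhds hS)
      _ ≤ ‖f x‖ + K * a := by gcongr; exact mem_closedBall_iff_norm.1 hy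
      _ ≤ M := by rw [hM]; push_cast; linarith
  have : 0 < M := by positivity
  refine ⟨a / (2 * M), by positivity, a, a / 2, M, by positivity,
    .of_time_independent hbound (hf.mono haS) (le_of_eq ?_)⟩
  have : (M : ℝ) ≠ 0 := by positivity
  simp only [sub_zero, zero_sub, neg_neg, max_self]
  push_cast
  field_simp
  norm_num

variable [NormedSpace ℝ E]

/-- `α` is an integral curve of the autonomous vector field `f` on the set of times `I`, with values
in `U`. -/
structure IsIntegralCurveIn (f : E → E) (U : Set E) (I : Set ℝ) (α : ℝ → E) : Prop where
  mapsTo : MapsTo α I U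
  isIntegralCurveOn : IsIntegralCurveOn α (fun _ => f) I

variable {f : E → E} {U : Set E} {I J : Set ℝ} {α β : ℝ → E}

namespace IsIntegralCurveIn

theorem mono (h : IsIntegralCurveIn f U I α) (hJ : J ⊆ I) : IsIntegralCurveIn f U J α :=
  ⟨h.mapsTo.mono_left hJ, h.isIntegralCurveOn.mono hJ⟩

theorem congr (h : IsIntegralCurveIn f U I α) (hαβ : EqOn β α I) : IsIntegralCurveIn f U I β where
  mapsTo := h.mapsTo.congr hαβ.symm
  isIntegralCurveOn t ht := by
    rw [hαβ ht]
    exact (h.isIntegralCurveOn t ht).congr hαβ (hαβ ht)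

theorem comp_sub (h : IsIntegralCurveIn f U I α) {c : ℝ} (hJ : MapsTo (· - c) J I) :
    IsIntegralCurveIn f U J (fun t => α (t - c)) where
  mapsTo := h.mapsTo.comp hJ
  isIntegralCurveOn t ht := by
    simpa [Function.comp_def] using (h.isIntegralCurveOn _ (hJ ht)).scomp t
      ((hasDerivWithinAt_id t J).sub_const c) hJ

theorem glue {c : ℝ} (hα : IsIntegralCurveIn f U (I ∩ Iic c) α)
    (hβ : IsIntegralCurveIn f U (I ∩ Ici c) β) (hc : α c = β c) :
    IsIntegralCurveIn f U I (fun t => if t ≤ c then α t else β t) := by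
  set g : ℝ → E := fun t => if t ≤ c then α t else β t
  have hleft : IsIntegralCurveIn f U (I ∩ Iic c) g := hα.congr fun t ht => if_pos ht.2
  have hright : IsIntegralCurveIn f U (I ∩ Ici c) g := hβ.congr fun t ht => by
    rcases (mem_Ici.1 ht.2).eq_or_lt with rfl | hlt
    · exact (if_pos le_rfl).trans hc
    · exact if_neg hlt.not_ge
  have hunion : I ∩ Iic c ∪ I ∩ Ici c = I := by
    rw [← inter_union_distrib_left, Iic_union_Ici, inter_univ]
  refine ⟨hunion ▸ hleft.mapsTo.union hright.mapsTo, fun t ht => ?_⟩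
  have hL : HasDerivWithinAt g (f (g t)) (I ∩ Iic c) t := by
    rcases le_or_gt t c with htc | htc
    · exact hleft.isIntegralCurveOn t ⟨ht, htc⟩
    · exact HasFDerivWithinAt.of_notMem_closure fun h =>
        htc.not_ge (closure_minimal inter_subset_right isClosed_Iic h)
  have hR : HasDerivWithinAt g (f (g t)) (I ∩ Ici c) t := by
    rcases le_or_gt c t with htc | htc
    · exact hright.isIntegralCurveOn t ⟨ht, htc⟩
    · exact HasFDerivWithinAt.of_notMem_closure fun h =>
        htc.not_ge (closure_minimal inter_subset_right isClosed_Ici h)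
  exact hunion ▸ hL.union hR

theorem exists_lipschitzOnWith_mapsTo (hf : LocallyLipschitzOn U f)
    (hα : IsIntegralCurveIn f U I α) (hβ : IsIntegralCurveIn f U I β) (hI : IsCompact I) :
    ∃ K S, LipschitzOnWith K f S ∧ MapsTo α I S ∧ MapsTo β I S := by
  obtain ⟨K, hK⟩ := (hf.mono (union_subset hα.mapsTo.image_subset hβ.mapsTo.image_subset))
    |>.exists_lipschitzOnWith_of_compact
      ((hI.image_of_continuousOn hα.isIntegralCurveOn.continuousOn).union
        (hI.image_of_continuousOn hβ.isIntegralCurveOn.continuousOn))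
  exact ⟨K, _, hK, fun t ht => .inl (mem_image_of_mem α ht),
    fun t ht => .inr (mem_image_of_mem β ht)⟩

theorem eqOn_Icc_of_eq_left (hf : LocallyLipschitzOn U f) {a b : ℝ}
    (hα : IsIntegralCurveIn f U (Icc a b) α) (hβ : IsIntegralCurveIn f U (Icc a b) β)
    (hab : α a = β a) : EqOn α β (Icc a b) := by
  obtain ⟨K, S, hK, hαS, hβS⟩ := hα.exists_lipschitzOnWith_mapsTo hf hβ isCompact_Icc
  have hsub : Ico a b ⊆ Icc a b := Ico_subset_Icc_self
  have hnhds : ∀ t ∈ Ico a b, Icc a b ∈ 𝓝[≥] t := fun t ht =>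
    mem_of_superset (Icc_mem_nhdsGE ht.2) (Icc_subset_Icc_left ht.1)
  exact ODE_solution_unique_of_mem_Icc_right (v := fun _ => f) (s := fun _ => S) (fun _ _ => hK)
    hα.isIntegralCurveOn.continuousOn
    (fun t ht => (hα.isIntegralCurveOn t (hsub ht)).mono_of_mem_nhdsWithin (hnhds t ht))
    (hαS.mono_left hsub) hβ.isIntegralCurveOn.continuousOn
    (fun t ht => (hβ.isIntegralCurveOn t (hsub ht)).mono_of_mem_nhdsWithin (hnhds t ht))
    (hβS.mono_left hsub) hab

theorem eqOn_Icc_of_eq_right (hf : LocallyLipschitzOn U f) {a b : ℝ}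
    (hα : IsIntegralCurveIn f U (Icc a b) α) (hβ : IsIntegralCurveIn f U (Icc a b) β)
    (hab : α b = β b) : EqOn α β (Icc a b) := by
  obtain ⟨K, S, hK, hαS, hβS⟩ := hα.exists_lipschitzOnWith_mapsTo hf hβ isCompact_Icc
  have hsub : Ioc a b ⊆ Icc a b := Ioc_subset_Icc_self
  have hnhds : ∀ t ∈ Ioc a b, Icc a b ∈ 𝓝[≤] t := fun t ht =>
    mem_of_superset (Icc_mem_nhdsLE ht.1) (Icc_subset_Icc_right ht.2)
  exact ODE_solution_unique_of_mem_Icc_left (v := fun _ => f) (s := fun _ => S) (fun _ _ => hK)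
    hα.isIntegralCurveOn.continuousOn
    (fun t ht => (hα.isIntegralCurveOn t (hsub ht)).mono_of_mem_nhdsWithin (hnhds t ht))
    (hαS.mono_left hsub) hβ.isIntegralCurveOn.continuousOn
    (fun t ht => (hβ.isIntegralCurveOn t (hsub ht)).mono_of_mem_nhdsWithin (hnhds t ht))
    (hβS.mono_left hsub) hab

theorem eqOn (hf : LocallyLipschitzOn U f) (hα : IsIntegralCurveIn f U I α)
    (hβ : IsIntegralCurveIn f U I β) (hI : I.OrdConnected) {a : ℝ} (ha : a ∈ I)
    (hab : α a = β a) : EqOn α β I := by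
  intro t ht
  rcases le_total a t with h | h
  · have hsub : Icc a t ⊆ I := hI.out ha ht
    exact eqOn_Icc_of_eq_left hf (hα.mono hsub) (hβ.mono hsub) hab ⟨h, le_rfl⟩
  · have hsub : Icc t a ⊆ I := hI.out ht ha
    exact eqOn_Icc_of_eq_right hf (hα.mono hsub) (hβ.mono hsub) hab ⟨le_rfl, h⟩

end IsIntegralCurveIn

theorem exists_eventually_exists_isIntegralCurveIn [CompleteSpace E] (hU : IsOpen U)
    (hf : LocallyLipschitzOn U f) {x : E} (hx : x ∈ U) :
    ∃ ε > 0, ∀ᶠ y in 𝓝 x, ∃ α : ℝ → E, α 0 = y ∧ IsIntegralCurveIn f U (Icc 0 ε) α := by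
  obtain ⟨K, S, hS, hK⟩ := hf hx
  obtain ⟨ε, hε, a, r, M, hr, hpl⟩ :=
    exists_isPicardLindelof_of_lipschitzOnWith hK (hU.nhdsWithin_eq hx ▸ hS)
  obtain ⟨Φ, hΦ, hΦc⟩ := hpl.exists_forall_mem_closedBall_eq_hasDerivWithinAt_continuousOn
  have hball : Metric.closedBall x (r : ℝ) ∈ 𝓝 x := Metric.closedBall_mem_nhds x hr
  have hΦx : ContinuousAt Φ (x, 0) :=
    hΦc.continuousAt (prod_mem_nhds hball (Icc_mem_nhds (by linarith) hε))
  have hΦU : ∀ᶠ p in 𝓝 x ×ˢ 𝓝 (0 : ℝ), Φ p ∈ U := by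
    rw [← nhds_prod_eq]
    exact hΦx.eventually (hU.mem_nhds (by rwa [(hΦ x (mem_of_mem_nhds hball)).1]))
  obtain ⟨P, hP, Q, hQ, hPQ⟩ := eventually_prod_iff.1 hΦU
  obtain ⟨ρ, hρ, hρQ⟩ := Metric.nhds_basis_closedBall.eventually_iff.1 hQ
  refine ⟨min ε ρ, lt_min hε hρ, ?_⟩
  filter_upwards [hP, hball] with y hyP hy
  have hsub : Icc 0 (min ε ρ) ⊆ Icc (-ε) ε := Icc_subset_Icc (by linarith) (min_le_left _ _)
  refine ⟨fun t => Φ (y, t), (hΦ y hy).1, fun t ht => hPQ hyP (hρQ ?_),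
    fun t ht => ((hΦ y hy).2 t (hsub ht)).mono hsub⟩
  rw [Metric.mem_closedBall, dist_zero_right, Real.norm_of_nonneg ht.1]
  exact ht.2.trans (min_le_right _ _)

theorem exists_isIntegralCurveIn_of_forall (hf : LocallyLipschitzOn U f) {x : E}
    (hI : I ⊆ Ici 0) (h0 : (0 : ℝ) ∈ I)
    (h : ∀ t ∈ I, ∃ T > t, ∃ α : ℝ → E, α 0 = x ∧ IsIntegralCurveIn f U (Icc 0 T) α) :
    ∃ α : ℝ → E, α 0 = x ∧ IsIntegralCurveIn f U I α := by
  choose! T hT β hβ0 hβ using h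
  have hmem : ∀ t ∈ I, t ∈ Icc 0 (T t) := fun t ht => ⟨hI ht, (hT t ht).le⟩
  have heq : ∀ t ∈ I, ∀ s ∈ I, s < T t → β s s = β t s := fun t ht s hs hst =>
    ((hβ s hs).mono (Icc_subset_Icc_right (hT s hs).le)).eqOn hf
      ((hβ t ht).mono (Icc_subset_Icc_right hst.le)) ordConnected_Icc ⟨le_rfl, hI hs⟩
      ((hβ0 s hs).trans (hβ0 t ht).symm) ⟨hI hs, le_rfl⟩
  refine ⟨fun t => β t t, hβ0 0 h0, fun t ht => (hβ t ht).mapsTo (hmem t ht), fun t ht => ?_⟩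
  have hlt : ∀ᶠ s in 𝓝[I] t, s ∈ I ∧ s < T t :=
    eventually_mem_nhdsWithin.and (nhdsWithin_le_nhds (eventually_lt_nhds (hT t ht)))
  exact (((hβ t ht).isIntegralCurveOn t (hmem t ht)).mono_of_mem_nhdsWithin
    (hlt.mono fun s hs => ⟨hI hs.1, hs.2.le⟩)).congr_of_eventuallyEq
      (hlt.mono fun s hs => heq t ht s hs.1 hs.2) rfl

theorem IsIntegralCurveIn.exists_extension [CompleteSpace E] (hU : IsOpen U)
    (hf : LocallyLipschitzOn U f) {T : ℝ} (hT : 0 < T) (hα : IsIntegralCurveIn f U (Ico 0 T) α)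
    {y : E} (hy : y ∈ U) (hcl : MapClusterPt y (𝓝[<] T) α) :
    ∃ T' > T, ∃ β : ℝ → E, β 0 = α 0 ∧ IsIntegralCurveIn f U (Icc 0 T') β := by
  obtain ⟨ε, hε, hlocal⟩ := exists_eventually_exists_isIntegralCurveIn hU hf hy
  have hnear : ∀ᶠ t in 𝓝[<] T, t ∈ Ioo (max 0 (T - ε)) T :=
    Ioo_mem_nhdsLT (max_lt hT (by linarith))
  obtain ⟨c, ⟨β, hβ0, hβ⟩, hc, hcT⟩ := ((hcl.frequently hlocal).and_eventually hnear).exists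
  obtain ⟨hc0, hcε⟩ := max_lt_iff.1 hc
  refine ⟨c + ε, by linarith, _, if_pos hc0.le,
    IsIntegralCurveIn.glue (hα.mono fun t ht => ⟨ht.1.1, ht.2.trans_lt hcT⟩)
      (hβ.comp_sub fun t ht => ⟨sub_nonneg.2 ht.2, sub_le_iff_le_add'.2 ht.1.2⟩) ?_⟩
  rw [sub_self, hβ0]

theorem exists_isIntegralCurveIn_Ici [CompleteSpace E] (hU : IsOpen U)
    (hf : LocallyLipschitzOn U f) {x : E} (hx : x ∈ U)
    (hacc : ∀ T > 0, ∀ α : ℝ → E, α 0 = x → IsIntegralCurveIn f U (Ico 0 T) α →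
      ∃ y ∈ U, MapClusterPt y (𝓝[<] T) α) :
    ∃ α : ℝ → E, α 0 = x ∧ IsIntegralCurveIn f U (Ici 0) α := by
  set S : Set ℝ := {T | ∃ α : ℝ → E, α 0 = x ∧ IsIntegralCurveIn f U (Icc 0 T) α}
  obtain ⟨ε, hε, hlocal⟩ := exists_eventually_exists_isIntegralCurveIn hU hf hx
  have hεS : ε ∈ S := hlocal.self_of_nhds
  suffices hunbdd : ¬ BddAbove S from
    exists_isIntegralCurveIn_of_forall hf Subset.rfl self_mem_Ici fun t _ => by
      obtain ⟨T, hT, htT⟩ := not_bddAbove_iff.1 hunbdd t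
      exact ⟨T, htT, hT⟩
  intro hbdd
  have hpos : 0 < sSup S := hε.trans_le (le_csSup hbdd hεS)
  obtain ⟨α, hα0, hα⟩ : ∃ α : ℝ → E, α 0 = x ∧ IsIntegralCurveIn f U (Ico 0 (sSup S)) α :=
    exists_isIntegralCurveIn_of_forall hf (fun t ht => ht.1) ⟨le_rfl, hpos⟩ fun t ht => by
      obtain ⟨T, hT, htT⟩ := exists_lt_of_lt_csSup ⟨ε, hεS⟩ ht.2
      exact ⟨T, htT, hT⟩
  obtain ⟨y, hy, hcl⟩ := hacc _ hpos α hα0 hα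
  obtain ⟨T, hT, β, hβ0, hβ⟩ := hα.exists_extension hU hf hpos hy hcl
  exact hT.not_ge (le_csSup hbdd ⟨β, hβ0.trans hα0, hβ⟩)

end ODE

/-! ### The equations of motion -/

theorem inner_plane (u v : Plane) : inner ℝ u v = u 0 * v 0 + u 1 * v 1 := by
  simp [PiLp.inner_apply, Fin.sum_univ_two, mul_comm]

@[simp] theorem rot_apply_zero (v : Plane) : rot v 0 = -(v 1) := rfl

@[simp] theorem rot_apply_one (v : Plane) : rot v 1 = v 0 := rfl

theorem plane_ext {u v : Plane} (h0 : u 0 = v 0) (h1 : u 1 = v 1) : u = v :=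
  PiLp.ext (Fin.forall_fin_two.2 ⟨h0, h1⟩)

/-- The rotation `rot` as a continuous linear map. -/
noncomputable def rotCLM : Plane →L[ℝ] Plane :=
  LinearMap.toContinuousLinearMap
    { toFun := rot
      map_add' := fun u v => plane_ext (by simp; ring) (by simp)
      map_smul' := fun c v => plane_ext (by simp) (by simp) }

theorem rotCLM_apply (v : Plane) : rotCLM v = rot v := rfl

theorem rot_rot (v : Plane) : rot (rot v) = -v := plane_ext (by simp) (by simp)

theorem rot_smul (c : ℝ) (v : Plane) : rot (c • v) = c • rot v := rotCLM.map_smul c v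

theorem rot_neg (v : Plane) : rot (-v) = -rot v := rotCLM.map_neg v

theorem inner_rot_self (v : Plane) : inner ℝ v (rot v) = 0 := by
  simp only [inner_plane, rot_apply_zero, rot_apply_one]; ring

theorem inner_rot_left (u v : Plane) : inner ℝ (rot u) v = -inner ℝ u (rot v) := by
  simp only [inner_plane, rot_apply_zero, rot_apply_one]; ring

theorem norm_rot (v : Plane) : ‖rot v‖ = ‖v‖ := by
  rw [← sq_eq_sq₀ (norm_nonneg _) (norm_nonneg _), ← real_inner_self_eq_norm_sq,
    ← real_inner_self_eq_norm_sq, inner_rot_left, rot_rot, inner_neg_right, neg_neg]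

theorem eq_inner_smul_add_inner_rot_smul {τ : Plane} (hτ : ‖τ‖ = 1) (u : Plane) :
    u = inner ℝ u τ • τ + inner ℝ u (rot τ) • rot τ := by
  have h : τ 0 * τ 0 + τ 1 * τ 1 = 1 := by
    rw [← inner_plane, real_inner_self_eq_norm_sq, hτ, one_pow]
  apply plane_ext <;>
    simp only [inner_plane, PiLp.add_apply, PiLp.smul_apply, smul_eq_mul, rot_apply_zero,
      rot_apply_one]
  · linear_combination (-(u 0)) * h
  · linear_combination (-(u 1)) * h

section LorentzField

variable {Ω : Set Plane} {A : Plane → Plane} {b : Plane → ℝ} {I : Set ℝ}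
  {z : ℝ → Plane × Plane}

/-- The vector field of the equations of motion `q' = v`, `v' = -b(q) rot v`, which are Hamilton's
equations written in terms of the velocity `v = p - A(q)`. -/
def lorentzField (b : Plane → ℝ) (x : Plane × Plane) : Plane × Plane :=
  (x.2, -(b x.1) • rot x.2)

theorem locallyLipschitzOn_lorentzField (hb : LocallyLipschitzOn Ω b) :
    LocallyLipschitzOn (Ω ×ˢ univ) (lorentzField b) := by
  rw [locallyLipschitzOn_iff_restrict]
  have hsmooth : LocallyLipschitz fun y : ℝ × Plane => (y.2, -y.1 • rotCLM y.2) :=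
    (by fun_prop : ContDiff ℝ 1 fun y : ℝ × Plane => (y.2, -y.1 • rotCLM y.2)).locallyLipschitz
  have hfst : LipschitzWith 1
      fun x : (Ω ×ˢ univ : Set (Plane × Plane)) => (⟨x.1.1, x.2.1⟩ : Ω) :=
    LipschitzWith.of_edist_le fun x y => le_max_left _ _
  have hpair : LocallyLipschitz
      fun x : (Ω ×ˢ univ : Set (Plane × Plane)) => (b x.1.1, x.1.2) :=
    (hb.restrict.comp hfst.locallyLipschitz).prodMk
    (LipschitzWith.prod_snd.comp (LipschitzWith.subtype_val _)).locallyLipschitz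
  have hcomp : (Ω ×ˢ univ).domRestrict (lorentzField b)
      = (fun y : ℝ × Plane => (y.2, -y.1 • rotCLM y.2)) ∘ fun x => (b x.1.1, x.1.2) := rfl
  exact hcomp ▸ hsmooth.comp hpair

theorem hasGradientAt_hamiltonian_momentum (A : Plane → Plane) (q p : Plane) :
    HasGradientAt (fun p => hamiltonian A q p) (p - A q) p := by
  rw [hasGradientAt_iff_hasFDerivAt]
  have h := ((hasFDerivAt_id (𝕜 := ℝ) p).sub_const (A q)).norm_sq.mul_const (2⁻¹ : ℝ)
  simp only [← div_eq_mul_inv] at h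
  refine h.congr_fderiv ?_
  ext w
  simp

theorem hasGradientAt_hamiltonian_position {q : Plane} (hA : DifferentiableAt ℝ A q) (p : Plane) :
    HasGradientAt (fun q => hamiltonian A q p)
      (-ContinuousLinearMap.adjoint (fderiv ℝ A q) (p - A q)) q := by
  rw [hasGradientAt_iff_hasFDerivAt]
  have h := (hA.hasFDerivAt.const_sub p).norm_sq.mul_const (2⁻¹ : ℝ)
  simp only [← div_eq_mul_inv] at h
  refine h.congr_fderiv ?_
  ext w
  simp [ContinuousLinearMap.adjoint_inner_left]

theorem IsVectorPotential.adjoint_fderiv_sub_fderiv (hA : IsVectorPotential Ω A b) {q : Plane}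
    (hq : q ∈ Ω) (v : Plane) :
    ContinuousLinearMap.adjoint (fderiv ℝ A q) v - fderiv ℝ A q v = -(b q) • rot v := by
  rw [← hA.2 q hq]
  set D := fderiv ℝ A q
  have hDv : D v = v 0 • D (EuclideanSpace.single 0 1) + v 1 • D (EuclideanSpace.single 1 1) := by
    rw [← map_smul, ← map_smul, ← map_add]
    exact congrArg D (plane_ext (by simp) (by simp))
  have hadj (i : Fin 2) : (ContinuousLinearMap.adjoint D v) i
      = v 0 * (D (EuclideanSpace.single i 1)) 0 + v 1 * (D (EuclideanSpace.single i 1)) 1 := by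
    rw [← inner_plane, ← ContinuousLinearMap.adjoint_inner_left,
      EuclideanSpace.inner_single_right, conj_trivial, one_mul]
  apply plane_ext <;>
    simp only [PiLp.sub_apply, hadj, hDv, PiLp.add_apply, PiLp.smul_apply, smul_eq_mul,
      rot_apply_zero, rot_apply_one] <;>
    ring

theorem IsVectorPotential.differentiableAt (hA : IsVectorPotential Ω A b) (hΩ : IsOpen Ω)
    {q : Plane} (hq : q ∈ Ω) : DifferentiableAt ℝ A q :=
  (hA.1.contDiffAt (hΩ.mem_nhds hq)).differentiableAt one_ne_zero

theorem IsVectorPotential.isIntegralCurveIn (hA : IsVectorPotential Ω A b) (hΩ : IsOpen Ω)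
    (hz : IsTrajectoryOn Ω A I z) :
    IsIntegralCurveIn (lorentzField b) (Ω ×ˢ univ) I
      (fun t => ((z t).1, (z t).2 - A (z t).1)) where
  mapsTo t ht := ⟨(hz t ht).1, mem_univ _⟩
  isIntegralCurveOn t ht := by
    obtain ⟨hq, hq', hp'⟩ := hz t ht
    have hAd := hA.differentiableAt hΩ hq
    rw [(hasGradientAt_hamiltonian_momentum A _ _).gradient] at hq'
    rw [(hasGradientAt_hamiltonian_position hAd _).gradient, neg_neg] at hp'
    refine hq'.prodMk ?_
    rw [← hA.adjoint_fderiv_sub_fderiv hq]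
    exact hp'.sub (hAd.hasFDerivAt.comp_hasDerivWithinAt t hq')

theorem hasDerivWithinAt_position {U : Set (Plane × Plane)}
    (hz : IsIntegralCurveIn (lorentzField b) U I z) {t : ℝ} (ht : t ∈ I) :
    HasDerivWithinAt (fun τ => (z τ).1) (z t).2 I t :=
  (hz.isIntegralCurveOn t ht).fst

theorem hasDerivWithinAt_velocity {U : Set (Plane × Plane)}
    (hz : IsIntegralCurveIn (lorentzField b) U I z) {t : ℝ} (ht : t ∈ I) :
    HasDerivWithinAt (fun τ => (z τ).2) (-(b (z t).1) • rot (z t).2) I t :=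
  (hz.isIntegralCurveOn t ht).snd

theorem norm_velocity_eq {U : Set (Plane × Plane)}
    (hz : IsIntegralCurveIn (lorentzField b) U I z) (hI : I.OrdConnected) {s t : ℝ} (hs : s ∈ I)
    (ht : t ∈ I) : ‖(z t).2‖ = ‖(z s).2‖ := by
  have hderiv : ∀ τ ∈ I, HasDerivWithinAt (fun τ => ‖(z τ).2‖ ^ 2) 0 I τ := fun τ hτ => by
    refine (hasDerivWithinAt_velocity hz hτ).norm_sq.congr_deriv ?_
    rw [inner_smul_right, inner_rot_self, mul_zero, mul_zero]
  have hle := hI.convex.norm_image_sub_le_of_norm_hasDerivWithin_le hderiv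
    (fun _ _ => norm_zero.le) hs ht
  rw [zero_mul, norm_le_zero_iff, sub_eq_zero] at hle
  exact (sq_eq_sq₀ (norm_nonneg _) (norm_nonneg _)).1 hle

theorem IsVectorPotential.isTrajectoryOn (hA : IsVectorPotential Ω A b) (hΩ : IsOpen Ω)
    (hz : IsIntegralCurveIn (lorentzField b) (Ω ×ˢ univ) I z) :
    IsTrajectoryOn Ω A I (fun t => ((z t).1, (z t).2 + A (z t).1)) := by
  intro t ht
  have hq := (hz.mapsTo ht).1
  have hAd := hA.differentiableAt hΩ hq
  have hq' := hasDerivWithinAt_position hz ht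
  have hp' := (hasDerivWithinAt_velocity hz ht).add
    (hAd.hasFDerivAt.comp_hasDerivWithinAt t hq')
  rw [← hA.adjoint_fderiv_sub_fderiv hq, sub_add_cancel] at hp'
  refine ⟨hq, ?_, ?_⟩
  · rwa [(hasGradientAt_hamiltonian_momentum A _ _).gradient, add_sub_cancel_right]
  · rwa [(hasGradientAt_hamiltonian_position hAd _).gradient, neg_neg, add_sub_cancel_right]

theorem isIntegralCurveIn_lorentzField_comp_neg
    (hz : IsIntegralCurveIn (lorentzField (-b)) (Ω ×ˢ univ) I z) :
    IsIntegralCurveIn (lorentzField b) (Ω ×ˢ univ) (-I)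
      (fun t => ((z (-t)).1, -(z (-t)).2)) where
  mapsTo t ht := ⟨(hz.mapsTo ht).1, mem_univ _⟩
  isIntegralCurveOn t ht := by
    have hneg : HasDerivWithinAt (fun τ : ℝ => -τ) (-1) (-I) t := hasDerivWithinAt_neg t (-I)
    have hq := (hasDerivWithinAt_position hz ht).scomp t hneg fun _ => id
    have hv := ((hasDerivWithinAt_velocity hz ht).scomp t hneg fun _ => id).neg
    refine (HasDerivWithinAt.prodMk hq hv).congr_deriv ?_
    simp [lorentzField, rot_neg]

end LorentzField

/-! ### Tubular coordinates -/

/-- The Jacobian determinant `1 - n κ(s)` of the tubular map at `x = (n, s)`. -/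
noncomputable def jacobian (γ : ℝ → Plane) (x : ℝ × ℝ) : ℝ := 1 - x.1 * curvature γ x.2

namespace IsArcLengthParam

variable {C : Set Plane} {γ : ℝ → Plane} {L : ℝ}

theorem hasDerivAt (h : IsArcLengthParam C γ L) (s : ℝ) : HasDerivAt γ (deriv γ s) s :=
  (h.contDiff.differentiable two_ne_zero s).hasDerivAt

theorem contDiff_deriv (h : IsArcLengthParam C γ L) : ContDiff ℝ 1 (deriv γ) :=
  h.contDiff.deriv'

theorem contDiff_normal (h : IsArcLengthParam C γ L) : ContDiff ℝ 1 (normal γ) :=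
  rotCLM.contDiff.comp h.contDiff_deriv

theorem norm_normal (h : IsArcLengthParam C γ L) (s : ℝ) : ‖normal γ s‖ = 1 :=
  (norm_rot _).trans (h.unit_speed s)

theorem hasDerivAt_deriv (h : IsArcLengthParam C γ L) (s : ℝ) :
    HasDerivAt (deriv γ) (curvature γ s • normal γ s) s := by
  have hd : HasDerivAt (deriv γ) (deriv (deriv γ) s) s :=
    (h.contDiff_deriv.differentiable one_ne_zero s).hasDerivAt
  have horth : inner ℝ (deriv (deriv γ) s) (deriv γ s) = 0 := by
    have hconst : (fun x => ‖deriv γ x‖ ^ 2) = fun _ => (1 : ℝ) :=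
      funext fun x => by rw [h.unit_speed, one_pow]
    have hzero := (hconst ▸ hd.norm_sq).unique (hasDerivAt_const s (1 : ℝ))
    rw [real_inner_comm]
    linarith
  have hframe := eq_inner_smul_add_inner_rot_smul (h.unit_speed s) (deriv (deriv γ) s)
  rw [horth, zero_smul, zero_add] at hframe
  exact hd.congr_deriv hframe

theorem hasDerivAt_normal (h : IsArcLengthParam C γ L) (s : ℝ) :
    HasDerivAt (normal γ) (-curvature γ s • deriv γ s) s := by
  have hN := rotCLM.hasFDerivAt.comp_hasDerivAt s (h.hasDerivAt_deriv s)
  rwa [rotCLM_apply, rot_smul, normal, rot_rot, smul_neg, ← neg_smul] at hN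

theorem continuous_curvature (h : IsArcLengthParam C γ L) : Continuous (curvature γ) :=
  h.contDiff_deriv.continuous_deriv_one.inner h.contDiff_normal.continuous

theorem periodic_curvature (h : IsArcLengthParam C γ L) : Function.Periodic (curvature γ) L :=
  fun s => by
    simp only [curvature, normal, periodic_deriv h.periodic s,
      periodic_deriv (periodic_deriv h.periodic) s]

theorem isBounded_range_curvature (h : IsArcLengthParam C γ L) :
    Bornology.IsBounded (range (curvature γ)) :=
  h.periodic_curvature.isBounded_of_continuous h.length_pos.ne' h.continuous_curvature

theorem exists_lipschitzWith_normal (h : IsArcLengthParam C γ L) :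
    ∃ K, LipschitzWith K (normal γ) := by
  obtain ⟨k, hk⟩ := h.isBounded_range_curvature.exists_norm_le
  refine ⟨k.toNNReal, lipschitzWith_of_nnnorm_deriv_le
    (h.contDiff_normal.differentiable one_ne_zero) fun s => ?_⟩
  refine NNReal.le_toNNReal_of_coe_le ?_
  rw [coe_nnnorm, (h.hasDerivAt_normal s).deriv, norm_smul, norm_neg, h.unit_speed, mul_one]
  exact hk _ (mem_range_self s)

theorem exists_lipschitzWith_curvature (h : IsArcLengthParam C γ L) :
    ∃ K, LipschitzWith K (curvature γ) := by
  obtain ⟨K', hK'⟩ := h.lipschitz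
  obtain ⟨KN, hKN⟩ := h.exists_lipschitzWith_normal
  have hb' : Bornology.IsBounded (range (deriv (deriv γ))) :=
    (periodic_deriv (periodic_deriv h.periodic)).isBounded_of_continuous h.length_pos.ne'
      hK'.continuous
  have hbN : Bornology.IsBounded (range (normal γ)) :=
    isBounded_iff_forall_norm_le.2 ⟨1, forall_mem_range.2 fun s => (h.norm_normal s).le⟩
  rw [← image_univ] at hb' hbN
  obtain ⟨K, hK⟩ :=
    exists_lipschitzOnWith_inner hK'.lipschitzOnWith hKN.lipschitzOnWith hb' hbN
  exact ⟨K, lipschitzOnWith_univ.1 hK⟩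

theorem exists_lipschitzOnWith_jacobian (h : IsArcLengthParam C γ L) {s : Set ℝ}
    (hs : Bornology.IsBounded s) : ∃ K, LipschitzOnWith K (jacobian γ) (s ×ˢ univ) := by
  obtain ⟨K, hK⟩ := h.exists_lipschitzWith_curvature
  have hbκ : Bornology.IsBounded ((fun x : ℝ × ℝ => curvature γ x.2) '' s ×ˢ univ) :=
    h.isBounded_range_curvature.subset (image_subset_iff.2 fun x _ => mem_range_self x.2)
  have hbn : Bornology.IsBounded (Prod.fst '' s ×ˢ (univ : Set ℝ)) :=
    hs.subset (fst_image_prod_subset _ _)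
  obtain ⟨K', hK'⟩ := exists_lipschitzOnWith_inner
    (hK.comp LipschitzWith.prod_snd).lipschitzOnWith
    LipschitzWith.prod_fst.lipschitzOnWith hbκ hbn
  exact ⟨_, (LipschitzWith.const (1 : ℝ)).lipschitzOnWith.sub hK'⟩

theorem eventually_jacobian_mem_Icc (h : IsArcLengthParam C γ L) :
    ∀ᶠ n in 𝓝 0, ∀ s, jacobian γ (n, s) ∈ Icc (1 / 2) 2 := by
  obtain ⟨k, hk⟩ := h.isBounded_range_curvature.exists_norm_le
  have hsmall : ∀ᶠ n : ℝ in 𝓝 0, |n| * k < 1 / 2 :=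
    (Continuous.tendsto' (by fun_prop) 0 0 (by simp)).eventually_lt_const (by norm_num)
  filter_upwards [hsmall] with n hn s
  have hle : |n * curvature γ s| ≤ |n| * k := by
    rw [abs_mul]
    exact mul_le_mul_of_nonneg_left (hk _ (mem_range_self s)) (abs_nonneg n)
  obtain ⟨h₁, h₂⟩ := abs_le.1 (hle.trans hn.le)
  constructor <;> rw [jacobian] <;> linarith

theorem contDiff_tubularMap (h : IsArcLengthParam C γ L) : ContDiff ℝ 1 (tubularMap γ) :=
  ((h.contDiff.of_le one_le_two).comp contDiff_snd).add
    (contDiff_fst.smul (h.contDiff_normal.comp contDiff_snd))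

theorem periodic_tubularMap (h : IsArcLengthParam C γ L) (n : ℝ) :
    Function.Periodic (fun s => tubularMap γ (n, s)) L := fun s => by
  simp only [tubularMap, normal, h.periodic s, periodic_deriv h.periodic s]

/-- The differential `(ν, σ) ↦ ν N + σ (1 - n κ) γ'` of the tubular map at a point `x = (n, s)`
where it is invertible. -/
noncomputable def tubularDeriv (h : IsArcLengthParam C γ L) {x : ℝ × ℝ} (hx : jacobian γ x ≠ 0) :
    (ℝ × ℝ) ≃L[ℝ] Plane :=
  ContinuousLinearEquiv.equivOfInverse
    ((ContinuousLinearMap.fst ℝ ℝ ℝ).smulRight (normal γ x.2)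
      + (jacobian γ x • ContinuousLinearMap.snd ℝ ℝ ℝ).smulRight (deriv γ x.2))
    ((innerSL ℝ (normal γ x.2)).prod ((jacobian γ x)⁻¹ • innerSL ℝ (deriv γ x.2)))
    (fun y => by
      have hTN : inner ℝ (deriv γ x.2) (normal γ x.2) = 0 := inner_rot_self _
      have hNT : inner ℝ (normal γ x.2) (deriv γ x.2) = 0 := by rw [real_inner_comm, hTN]
      ext
      · simp [inner_add_right, inner_smul_right, hNT, h.norm_normal]
      · simp [inner_add_right, inner_smul_right, hTN, hx, h.unit_speed])
    (fun v => by
      conv_rhs => rw [eq_inner_smul_add_inner_rot_smul (h.unit_speed x.2) v]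
      simp only [ContinuousLinearMap.prod_apply, innerSL_apply_apply, _root_.smul_apply,
        _root_.add_apply, ContinuousLinearMap.smulRight_apply, ContinuousLinearMap.coe_fst',
        ContinuousLinearMap.coe_snd', smul_eq_mul, mul_inv_cancel_left₀ hx, real_inner_comm v]
      exact add_comm _ _)

theorem tubularDeriv_symm_apply (h : IsArcLengthParam C γ L) {x : ℝ × ℝ}
    (hx : jacobian γ x ≠ 0) (v : Plane) : (h.tubularDeriv hx).symm v
      = (inner ℝ v (normal γ x.2), (jacobian γ x)⁻¹ * inner ℝ v (deriv γ x.2)) := by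
  rw [real_inner_comm, real_inner_comm (deriv γ x.2)]
  rfl

theorem hasStrictFDerivAt_tubularMap (h : IsArcLengthParam C γ L) {x : ℝ × ℝ}
    (hx : jacobian γ x ≠ 0) :
    HasStrictFDerivAt (tubularMap γ) (h.tubularDeriv hx : ℝ × ℝ →L[ℝ] Plane) x := by
  refine h.contDiff_tubularMap.contDiffAt.hasStrictFDerivAt' ?_ one_ne_zero
  have hγ : HasFDerivAt (fun x : ℝ × ℝ => γ x.2) _ x :=
    (h.hasDerivAt x.2).hasFDerivAt.comp x hasFDerivAt_snd
  have hN : HasFDerivAt (fun x : ℝ × ℝ => normal γ x.2) _ x :=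
    (h.hasDerivAt_normal x.2).hasFDerivAt.comp x hasFDerivAt_snd
  refine (hγ.add ((hasFDerivAt_fst (𝕜 := ℝ) (p := x)).smul hN)).congr_fderiv ?_
  ext1
  · ext1
    simp [tubularDeriv]
  · ext1
    simp [tubularDeriv, jacobian, add_smul, mul_smul, sub_eq_add_neg]

end IsArcLengthParam

/-- The tubular coordinates `(n, s)` of a point of the `δ`-collar, with `s ∈ [0, L)`. They are
discontinuous where `s = 0`, so they are only composed with functions that are `L`-periodic
in `s`; outside the collar their value is meaningless. -/
noncomputable def tubularCoord (γ : ℝ → Plane) (L δ : ℝ) : Plane → ℝ × ℝ :=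
  Function.invFunOn (tubularMap γ) (Ioo 0 δ ×ˢ Ico 0 L)

theorem eq_of_periodic {X : Type*} {f : ℝ → X} {L : ℝ} (hf : Function.Periodic f L) {s s' : ℝ}
    (hs : (s : AddCircle L) = s') : f s = f s' := by
  rw [← hf.lift_coe, hs, hf.lift_coe]

namespace IsTubularWidth

variable {Ω C : Set Plane} {γ : ℝ → Plane} {L δ : ℝ} {p : Plane}

theorem bijOn_collar (hδ : IsTubularWidth Ω C γ L δ) :
    BijOn (tubularMap γ) (Ioo 0 δ ×ˢ Ico 0 L) (collar Ω C δ) :=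
  hδ.bijOn δ ⟨hδ.pos, le_rfl⟩

theorem tubularCoord_mem (hδ : IsTubularWidth Ω C γ L δ) (hp : p ∈ collar Ω C δ) :
    tubularCoord γ L δ p ∈ Ioo 0 δ ×ˢ Ico 0 L :=
  Function.invFunOn_mem (hδ.bijOn_collar.surjOn hp)

theorem tubularMap_tubularCoord (hδ : IsTubularWidth Ω C γ L δ) (hp : p ∈ collar Ω C δ) :
    tubularMap γ (tubularCoord γ L δ p) = p :=
  Function.invFunOn_eq (hδ.bijOn_collar.surjOn hp)

theorem jacobian_apply_ne_zero (hδ : IsTubularWidth Ω C γ L δ) {x : ℝ × ℝ} (hx : x.1 ∈ Ioo 0 δ) :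
    jacobian γ x ≠ 0 :=
  hδ.jacobian_ne_zero x.1 hx x.2

theorem fst_tubularCoord (hδ : IsTubularWidth Ω C γ L δ) (hp : p ∈ collar Ω C δ) :
    (tubularCoord γ L δ p).1 = Metric.infDist p C := by
  obtain ⟨hn, hs⟩ := hδ.tubularCoord_mem hp
  have hx := hδ.tubularMap_tubularCoord hp
  set x := tubularCoord γ L δ p
  refine le_antisymm (not_lt.1 fun hlt => ?_) (le_of_forall_gt_imp_ge_of_dense fun n hxn => ?_)
  · obtain ⟨y, hy, hyp⟩ := (hδ.bijOn x.1 (Ioo_subset_Ioc_self hn)).surjOn ⟨hp.1, hlt⟩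
    have hxy : y = x := hδ.bijOn_collar.injOn
      ⟨Ioo_subset_Ioo_right hn.2.le hy.1, hy.2⟩ ⟨hn, hs⟩ (hyp.trans hx.symm)
    exact hy.1.2.ne (congrArg Prod.fst hxy)
  · have hmem : tubularMap γ x ∈ collar Ω C (min n δ) :=
      (hδ.bijOn _ ⟨lt_min (hn.1.trans hxn) hδ.pos, min_le_right n δ⟩).mapsTo
        ⟨⟨hn.1, lt_min hxn hn.2⟩, hs⟩
    rw [hx] at hmem
    exact hmem.2.le.trans (min_le_left n δ)

theorem tubularMap_mem_collar (hδ : IsTubularWidth Ω C γ L δ) (h : IsArcLengthParam C γ L)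
    {x : ℝ × ℝ} (hx : x.1 ∈ Ioo 0 δ) : tubularMap γ x ∈ collar Ω C δ := by
  obtain ⟨s, hs, hxs⟩ := (h.periodic_tubularMap x.1).exists_mem_Ico₀ h.length_pos x.2
  exact hxs ▸ hδ.bijOn_collar.mapsTo ⟨hx, hs⟩

theorem tubularCoord_tubularMap (hδ : IsTubularWidth Ω C γ L δ) (h : IsArcLengthParam C γ L)
    {x : ℝ × ℝ} (hx : x.1 ∈ Ioo 0 δ) :
    (tubularCoord γ L δ (tubularMap γ x)).1 = x.1 ∧
      ((tubularCoord γ L δ (tubularMap γ x)).2 : AddCircle L) = x.2 := by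
  have hper : Function.Periodic (fun s : ℝ => (tubularMap γ (x.1, s), (s : AddCircle L))) L :=
    fun s => Prod.ext (h.periodic_tubularMap x.1 s) (AddCircle.coe_add_period L s)
  obtain ⟨s, hs, hxs⟩ := hper.exists_mem_Ico₀ h.length_pos x.2
  obtain ⟨hmap, hcoe⟩ := Prod.mk.inj hxs
  have hinv : tubularCoord γ L δ (tubularMap γ (x.1, s)) = (x.1, s) :=
    hδ.bijOn_collar.injOn.leftInvOn_invFunOn ⟨hx, hs⟩
  rw [show tubularMap γ x = tubularMap γ (x.1, s) from hmap, hinv]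
  exact ⟨rfl, hcoe.symm⟩

theorem exists_tubular_lift (hδ : IsTubularWidth Ω C γ L δ) (h : IsArcLengthParam C γ L)
    {q : ℝ → Plane} {v : Plane} {t : ℝ} (hq : HasDerivAt q v t) (hqt : q t ∈ collar Ω C δ) :
    ∃ x : ℝ → ℝ × ℝ, x t = tubularCoord γ L δ (q t) ∧
      HasDerivAt x (inner ℝ v (normal γ (x t).2),
        (jacobian γ (x t))⁻¹ * inner ℝ v (deriv γ (x t).2)) t ∧
      ∀ᶠ τ in 𝓝 t, (x τ).1 ∈ Ioo 0 δ ∧ (tubularCoord γ L δ (q τ)).1 = (x τ).1 ∧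
        ((tubularCoord γ L δ (q τ)).2 : AddCircle L) = (x τ).2 := by
  have hx₀ := (hδ.tubularCoord_mem hqt).1
  have hqx := hδ.tubularMap_tubularCoord hqt
  set x₀ := tubularCoord γ L δ (q t)
  have hstrict := h.hasStrictFDerivAt_tubularMap (hδ.jacobian_apply_ne_zero hx₀)
  set g := hstrict.localInverse (tubularMap γ) _ x₀
  have hgt : g (q t) = x₀ := hqx ▸ hstrict.localInverse_apply_image
  have hderiv : HasDerivAt (g ∘ q) _ t :=
    (hqx ▸ hstrict.to_localInverse.hasFDerivAt : HasFDerivAt g _ (q t)).comp_hasDerivAt t hq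
  refine ⟨g ∘ q, hgt, ?_, ?_⟩
  · rw [Function.comp_apply, hgt]
    exact hderiv.congr_deriv (h.tubularDeriv_symm_apply _ v)
  · have hright : ∀ᶠ τ in 𝓝 t, tubularMap γ (g (q τ)) = q τ :=
      hq.continuousAt.eventually (hqx ▸ hstrict.eventually_right_inverse)
    have hmem : ∀ᶠ τ in 𝓝 t, (g (q τ)).1 ∈ Ioo 0 δ :=
      (continuous_fst.continuousAt.comp hderiv.continuousAt).eventually
        (isOpen_Ioo.mem_nhds (by rwa [Function.comp_apply, Function.comp_apply, hgt]))
    filter_upwards [hright, hmem] with τ hτ hτmem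
    exact ⟨hτmem, hτ ▸ hδ.tubularCoord_tubularMap h hτmem⟩

end IsTubularWidth

/-! ### Confinement near a boundary curve -/

/-- The mean of the magnetic field over the level line `n` of the distance to the boundary curve,
in tubular coordinates. -/
noncomputable def meanField (b : Plane → ℝ) (γ : ℝ → Plane) (L n : ℝ) : ℝ :=
  1 / L * ∫ ξ in (0 : ℝ)..L, tubularField b γ n ξ

/-- The flux of the mean magnetic field between the level lines `n` and `δ`. -/
noncomputable def meanFlux (b : Plane → ℝ) (γ : ℝ → Plane) (L δ n : ℝ) : ℝ :=
  ∫ η in n..δ, meanField b γ L η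

/-- The magnetic field `b` confines the motion near a boundary curve: its flux near the curve is
infinite, while its deviation from the mean over the level lines is bounded. -/
structure IsConfining (b : Plane → ℝ) (γ : ℝ → Plane) (L δ : ℝ) : Prop where
  tendsto_flux : Tendsto (fun n : ℝ => |∫ η in n..δ, ∫ ξ in (0 : ℝ)..L, tubularField b γ η ξ|)
    (𝓝[>] 0) atTop
  exists_abs_sub_le : ∃ M : ℝ, ∀ n ∈ Ioo 0 δ, ∀ s : ℝ,
    |tubularField b γ n s - meanField b γ L n| ≤ M

/-- The mean flux minus the tangential momentum `(1 - n κ(s)) ⟨v, γ'(s)⟩`, as a function of the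
position and the velocity. It would be conserved if `B` and `κ` did not depend on `s`. -/
noncomputable def fluxMomentum (b : Plane → ℝ) (γ : ℝ → Plane) (L δ : ℝ) (x : Plane × Plane) : ℝ :=
  meanFlux b γ L δ (tubularCoord γ L δ x.1).1
    - jacobian γ (tubularCoord γ L δ x.1) * inner ℝ x.2 (deriv γ (tubularCoord γ L δ x.1).2)

section Flux

variable {Ω C : Set Plane} {b : Plane → ℝ} {γ : ℝ → Plane} {L δ : ℝ}

theorem meanFlux_eq (n : ℝ) : meanFlux b γ L δ n
    = 1 / L * ∫ η in n..δ, ∫ ξ in (0 : ℝ)..L, tubularField b γ η ξ :=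
  intervalIntegral.integral_const_mul _ _

theorem tubularField_neg (n s : ℝ) : tubularField (-b) γ n s = -tubularField b γ n s := by
  simp only [tubularField, Pi.neg_apply, neg_mul]

theorem meanField_neg (n : ℝ) : meanField (-b) γ L n = -meanField b γ L n := by
  simp only [meanField, tubularField_neg, intervalIntegral.integral_neg, mul_neg]

theorem IsConfining.neg (hconf : IsConfining b γ L δ) : IsConfining (-b) γ L δ where
  tendsto_flux := by
    simpa only [tubularField_neg, intervalIntegral.integral_neg, abs_neg] using hconf.tendsto_flux
  exists_abs_sub_le := by
    simpa only [tubularField_neg, meanField_neg, neg_sub_neg, abs_sub_comm]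
      using hconf.exists_abs_sub_le

theorem IsConfining.tendsto_abs_meanFlux (hconf : IsConfining b γ L δ) (hL : 0 < L) :
    Tendsto (fun n => |meanFlux b γ L δ n|) (𝓝[>] 0) atTop := by
  simp only [meanFlux_eq, abs_mul]
  exact hconf.tendsto_flux.const_mul_atTop (abs_pos.2 (one_div_pos.2 hL).ne')

theorem continuousOn_meanField (h : IsArcLengthParam C γ L) (hδ : IsTubularWidth Ω C γ L δ)
    (hb : ContinuousOn b Ω) : ContinuousOn (meanField b γ L) (Ioo 0 δ) := by
  refine ContinuousOn.mul continuousOn_const ?_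
  rw [continuousOn_iff_continuous_domRestrict]
  refine intervalIntegral.continuous_parametric_intervalIntegral_of_continuous'
    (f := fun (η : Ioo 0 δ) ξ => tubularField b γ η ξ) ?_ 0 L
  have hψ : Continuous fun x : Ioo 0 δ × ℝ => tubularMap γ (x.1, x.2) :=
    h.contDiff_tubularMap.continuous.comp (by fun_prop)
  have hbψ : Continuous fun x : Ioo 0 δ × ℝ => b (tubularMap γ (x.1, x.2)) :=
    hb.comp_continuous hψ fun x => (hδ.tubularMap_mem_collar h x.1.2).1
  have hκ := h.continuous_curvature
  exact hbψ.neg.mul (by fun_prop)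

theorem hasDerivAt_meanFlux (h : IsArcLengthParam C γ L) (hδ : IsTubularWidth Ω C γ L δ)
    (hb : ContinuousOn b Ω) (hconf : IsConfining b γ L δ) {n : ℝ} (hn : n ∈ Ioo 0 δ) :
    HasDerivAt (meanFlux b γ L δ) (-meanField b γ L n) n := by
  have hcont := continuousOn_meanField h hδ hb
  -- a nonzero integral cannot be the junk value of a non-integrable function
  have hint : IntervalIntegrable (meanField b γ L) MeasureTheory.volume n δ := by
    obtain ⟨m, hm, -, hmn⟩ :=
      (((hconf.tendsto_abs_meanFlux h.length_pos).eventually_gt_atTop 0).and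
        (Ioo_mem_nhdsGT hn.1)).exists
    refine (intervalIntegral.intervalIntegrable_of_integral_ne_zero (abs_pos.1 hm)).mono_set ?_
    rw [uIcc_of_le hn.2.le, uIcc_of_le (hmn.trans hn.2).le]
    exact Icc_subset_Icc_left hmn.le
  exact intervalIntegral.integral_hasDerivAt_left hint
    (hcont.stronglyMeasurableAtFilter isOpen_Ioo n hn) (hcont.continuousAt (isOpen_Ioo.mem_nhds hn))

section Curve

variable {q v : ℝ → Plane} {w : Plane} {t : ℝ}

theorem hasDerivAt_fst_tubularCoord (h : IsArcLengthParam C γ L) (hδ : IsTubularWidth Ω C γ L δ)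
    (hq : HasDerivAt q w t) (hqt : q t ∈ collar Ω C δ) :
    HasDerivAt (fun τ => (tubularCoord γ L δ (q τ)).1)
      (inner ℝ w (normal γ (tubularCoord γ L δ (q t)).2)) t := by
  obtain ⟨x, hxt, hx, hlift⟩ := hδ.exists_tubular_lift h hq hqt
  have hfst := (hasFDerivAt_fst (𝕜 := ℝ) (p := x t)).comp_hasDerivAt t hx
  rw [← hxt]
  exact hfst.congr_of_eventuallyEq (hlift.mono fun τ hτ => hτ.2.1)

theorem hasDerivAt_tangent (h : IsArcLengthParam C γ L) (hδ : IsTubularWidth Ω C γ L δ)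
    (hq : HasDerivAt q w t) (hqt : q t ∈ collar Ω C δ) :
    HasDerivAt (fun τ => deriv γ (tubularCoord γ L δ (q τ)).2)
      (((jacobian γ (tubularCoord γ L δ (q t)))⁻¹
        * inner ℝ w (deriv γ (tubularCoord γ L δ (q t)).2))
        • curvature γ (tubularCoord γ L δ (q t)).2 • normal γ (tubularCoord γ L δ (q t)).2) t := by
  obtain ⟨x, hxt, hx, hlift⟩ := hδ.exists_tubular_lift h hq hqt
  have hsnd := (hasFDerivAt_snd (𝕜 := ℝ) (p := x t)).comp_hasDerivAt t hx
  have htangent := HasDerivAt.scomp (g₁ := deriv γ) t (h.hasDerivAt_deriv (x t).2) hsnd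
  rw [← hxt]
  exact htangent.congr_of_eventuallyEq
    (hlift.mono fun τ hτ => eq_of_periodic (periodic_deriv h.periodic) hτ.2.2)

theorem eventually_abs_jacobian_sub_le (h : IsArcLengthParam C γ L)
    (hδ : IsTubularWidth Ω C γ L δ) {K : NNReal}
    (hK : LipschitzOnWith K (jacobian γ) (Ioo 0 δ ×ˢ univ)) (hq : HasDerivAt q w t)
    (hqt : q t ∈ collar Ω C δ) (hJ : 1 / 2 ≤ jacobian γ (tubularCoord γ L δ (q t))) :
    ∀ᶠ τ in 𝓝 t, |jacobian γ (tubularCoord γ L δ (q τ)) - jacobian γ (tubularCoord γ L δ (q t))|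
      ≤ K * (2 * ‖w‖ + 1) * |τ - t| := by
  obtain ⟨x, hxt, hx, hlift⟩ := hδ.exists_tubular_lift h hq hqt
  rw [← hxt] at hJ ⊢
  have hnorm {u : Plane} (hu : ‖u‖ = 1) : ‖inner ℝ w u‖ ≤ ‖w‖ := by
    simpa only [hu, mul_one] using norm_inner_le_norm (𝕜 := ℝ) w u
  have hinv : ‖(jacobian γ (x t))⁻¹‖ ≤ 2 := by
    rw [norm_inv, Real.norm_of_nonneg (by linarith)]
    exact inv_le_of_inv_le₀ two_pos (by linarith)
  have hspeed : ‖(inner ℝ w (normal γ (x t).2),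
      (jacobian γ (x t))⁻¹ * inner ℝ w (deriv γ (x t).2))‖ < 2 * ‖w‖ + 1 := by
    refine (max_le ?_ ?_).trans_lt (lt_add_one (2 * ‖w‖))
    · linarith [hnorm (h.norm_normal (x t).2), norm_nonneg w]
    · rw [norm_mul]
      exact mul_le_mul hinv (hnorm (h.unit_speed _)) (norm_nonneg _) two_pos.le
  filter_upwards [eventually_norm_sub_le_of_hasDerivAt hx hspeed, hlift] with τ hτ hliftτ
  have hJτ : jacobian γ (tubularCoord γ L δ (q τ)) = jacobian γ (x τ) := by
    rw [jacobian, hliftτ.2.1, eq_of_periodic h.periodic_curvature hliftτ.2.2, ← jacobian]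
  rw [hJτ, mul_assoc]
  exact (hK.norm_sub_le ⟨hliftτ.1, mem_univ _⟩ ⟨hlift.self_of_nhds.1, mem_univ _⟩).trans
    (mul_le_mul_of_nonneg_left hτ K.coe_nonneg)

theorem hasDerivAt_inner_tangent (h : IsArcLengthParam C γ L) (hδ : IsTubularWidth Ω C γ L δ)
    (hq : HasDerivAt q (v t) t) (hv : HasDerivAt v (-(b (q t)) • rot (v t)) t)
    (hqt : q t ∈ collar Ω C δ) :
    HasDerivAt (fun τ => inner ℝ (v τ) (deriv γ (tubularCoord γ L δ (q τ)).2))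
      ((b (q t) + curvature γ (tubularCoord γ L δ (q t)).2
        * ((jacobian γ (tubularCoord γ L δ (q t)))⁻¹
          * inner ℝ (v t) (deriv γ (tubularCoord γ L δ (q t)).2)))
        * inner ℝ (v t) (normal γ (tubularCoord γ L δ (q t)).2)) t := by
  refine (hv.inner ℝ (hasDerivAt_tangent h hδ hq hqt)).congr_deriv ?_
  simp only [normal, inner_smul_right, real_inner_smul_left, inner_rot_left]
  ring

theorem abs_meanField_mul_sub_le {x : ℝ × ℝ} (hJ : jacobian γ x ≠ 0) {M k c ν a : ℝ}
    (hM : |tubularField b γ x.1 x.2 - meanField b γ L x.1| ≤ M) (hk : |curvature γ x.2| ≤ k)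
    (hν : |ν| ≤ c) (ha : |a| ≤ c) :
    |-meanField b γ L x.1 * ν - jacobian γ x
      * ((b (tubularMap γ x) + curvature γ x.2 * ((jacobian γ x)⁻¹ * a)) * ν)|
      ≤ M * c + k * c * c := by
  have hc : 0 ≤ c := (abs_nonneg a).trans ha
  have hid : -meanField b γ L x.1 * ν - jacobian γ x
      * ((b (tubularMap γ x) + curvature γ x.2 * ((jacobian γ x)⁻¹ * a)) * ν)
      = (tubularField b γ x.1 x.2 - meanField b γ L x.1) * ν - curvature γ x.2 * a * ν := by
    rw [tubularField, ← jacobian]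
    field_simp
    ring
  rw [hid]
  refine (abs_sub _ _).trans (add_le_add ?_ ?_)
  · rw [abs_mul]
    exact mul_le_mul hM hν (abs_nonneg _) ((abs_nonneg _).trans hM)
  · rw [abs_mul, abs_mul]
    have hk0 : 0 ≤ k := (abs_nonneg _).trans hk
    gcongr

end Curve

section Motion

variable {I : Set ℝ} {z : ℝ → Plane × Plane}

theorem exists_lipschitzOnWith_fluxMomentum (h : IsArcLengthParam C γ L)
    (hδ : IsTubularWidth Ω C γ L δ) (hb : ContinuousOn b Ω) (hconf : IsConfining b γ L δ)
    (hz : IsIntegralCurveIn (lorentzField b) (Ω ×ˢ univ) I z) (hIo : IsOpen I)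
    (hI : I.OrdConnected) (hcol : ∀ t ∈ I, (z t).1 ∈ collar Ω C δ)
    (hJ : ∀ t ∈ I, 1 / 2 ≤ jacobian γ (tubularCoord γ L δ (z t).1)) :
    ∃ Λ, LipschitzOnWith Λ (fun t => fluxMomentum b γ L δ (z t)) I := by
  obtain ⟨M, hM⟩ := hconf.exists_abs_sub_le
  obtain ⟨k, hk⟩ := h.isBounded_range_curvature.exists_norm_le
  obtain ⟨K, hK⟩ := h.exists_lipschitzOnWith_jacobian (Metric.isBounded_Ioo 0 δ)
  rcases I.eq_empty_or_nonempty with rfl | ⟨t₀, ht₀⟩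
  · exact ⟨0, lipschitzOnWith_empty 0 _⟩
  set c := ‖(z t₀).2‖
  have hspeed {t : ℝ} (ht : t ∈ I) : ‖(z t).2‖ = c := norm_velocity_eq hz hI ht₀ ht
  have hq {t : ℝ} (ht : t ∈ I) : HasDerivAt (fun τ => (z τ).1) (z t).2 t :=
    (hasDerivWithinAt_position hz ht).hasDerivAt (hIo.mem_nhds ht)
  have hv {t : ℝ} (ht : t ∈ I) : HasDerivAt (fun τ => (z τ).2) (-(b (z t).1) • rot (z t).2) t :=
    (hasDerivWithinAt_velocity hz ht).hasDerivAt (hIo.mem_nhds ht)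
  have hinner {t : ℝ} (ht : t ∈ I) {e : Plane} (he : ‖e‖ = 1) : |inner ℝ (z t).2 e| ≤ c := by
    simpa only [he, mul_one, hspeed ht] using abs_real_inner_le_norm (z t).2 e
  have hx {t : ℝ} (ht : t ∈ I) := (hδ.tubularCoord_mem (hcol t ht)).1
  have hflux {t : ℝ} (ht : t ∈ I) := HasDerivAt.comp (h₂ := meanFlux b γ L δ) t
    (hasDerivAt_meanFlux h hδ hb hconf (hx ht))
    (hasDerivAt_fst_tubularCoord h hδ (hq ht) (hcol t ht))
  refine ⟨_, lipschitzOnWith_sub_mul (D := M * c + k * c * c + 1) (c := c + 1) hI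
    (fun t ht => hflux ht)
    (fun t ht => hasDerivAt_inner_tangent h hδ (hq ht) (hv ht) (hcol t ht))
    (fun t ht => ?_) (fun t ht => (hinner ht (h.unit_speed _)).trans_lt (lt_add_one c))
    (fun t ht => hspeed ht ▸
      eventually_abs_jacobian_sub_le h hδ hK (hq ht) (hcol t ht) (hJ t ht))⟩
  have hle := abs_meanField_mul_sub_le (b := b) (L := L)
    (hδ.jacobian_apply_ne_zero (hx ht)) (hM _ (hx ht) _) (hk _ (mem_range_self _))
    (hinner ht (h.norm_normal (tubularCoord γ L δ (z t).1).2))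
    (hinner ht (h.unit_speed (tubularCoord γ L δ (z t).1).2))
  rw [hδ.tubularMap_tubularCoord (hcol t ht)] at hle
  exact hle.trans_lt (lt_add_one _)

theorem abs_meanFlux_le {x : Plane × Plane} {J : ℝ} (h : IsArcLengthParam C γ L)
    (hJ : |jacobian γ (tubularCoord γ L δ x.1)| ≤ J) :
    |meanFlux b γ L δ (tubularCoord γ L δ x.1).1| ≤ |fluxMomentum b γ L δ x| + J * ‖x.2‖ := by
  have hinner : |inner ℝ x.2 (deriv γ (tubularCoord γ L δ x.1).2)| ≤ ‖x.2‖ := by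
    simpa only [h.unit_speed, mul_one]
      using abs_real_inner_le_norm x.2 (deriv γ (tubularCoord γ L δ x.1).2)
  calc |meanFlux b γ L δ (tubularCoord γ L δ x.1).1|
      = |fluxMomentum b γ L δ x + jacobian γ (tubularCoord γ L δ x.1)
          * inner ℝ x.2 (deriv γ (tubularCoord γ L δ x.1).2)| := by
        rw [fluxMomentum, sub_add_cancel]
    _ ≤ |fluxMomentum b γ L δ x| + |jacobian γ (tubularCoord γ L δ x.1)|
          * |inner ℝ x.2 (deriv γ (tubularCoord γ L δ x.1).2)| := by
        rw [← abs_mul]; exact abs_add_le _ _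
    _ ≤ |fluxMomentum b γ L δ x| + J * ‖x.2‖ := by
        gcongr
        exact (abs_nonneg _).trans hJ

theorem tendsto_fst_tubularCoord {X : Type*} {l : Filter X} {q : X → Plane} {p : Plane}
    (hδ : IsTubularWidth Ω C γ L δ) (hp : p ∈ C) (hqΩ : ∀ᶠ t in l, q t ∈ Ω)
    (hq : Tendsto q l (𝓝 p)) :
    (∀ᶠ t in l, q t ∈ collar Ω C δ) ∧
      Tendsto (fun t => (tubularCoord γ L δ (q t)).1) l (𝓝[>] 0) := by
  have hdist : Tendsto (fun t => Metric.infDist (q t) C) l (𝓝 0) := by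
    simpa only [Metric.infDist_zero_of_mem hp, Function.comp_def]
      using ((Metric.continuous_infDist_pt C).tendsto p).comp hq
  have hcol : ∀ᶠ t in l, q t ∈ collar Ω C δ := hqΩ.and (hdist.eventually_lt_const hδ.pos)
  exact ⟨hcol, tendsto_nhdsWithin_iff.2
    ⟨hdist.congr' (hcol.mono fun t ht => (hδ.fst_tubularCoord ht).symm),
      hcol.mono fun t ht => (hδ.tubularCoord_mem ht).1.1⟩⟩

theorem not_tendsto_boundary (h : IsArcLengthParam C γ L) (hδ : IsTubularWidth Ω C γ L δ)
    (hb : ContinuousOn b Ω) (hconf : IsConfining b γ L δ) {T : ℝ} (hT : 0 < T)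
    (hz : IsIntegralCurveIn (lorentzField b) (Ω ×ˢ univ) (Ico 0 T) z) {p : Plane} (hp : p ∈ C) :
    ¬ Tendsto (fun t => (z t).1) (𝓝[<] T) (𝓝 p) := by
  intro hlim
  have hIoo : ∀ᶠ t in 𝓝[<] T, t ∈ Ioo 0 T := Ioo_mem_nhdsLT hT
  obtain ⟨hcol, hn⟩ := tendsto_fst_tubularCoord hδ hp
    (hIoo.mono fun t ht => (hz.mapsTo (Ioo_subset_Ico_self ht)).1) hlim
  have hJ : ∀ᶠ t in 𝓝[<] T, jacobian γ (tubularCoord γ L δ (z t).1) ∈ Icc (1 / 2) 2 :=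
    ((tendsto_nhds_of_tendsto_nhdsWithin hn).eventually h.eventually_jacobian_mem_Icc).mono
      fun t ht => ht _
  obtain ⟨a, haT : a < T, ha⟩ :=
    mem_nhdsLT_iff_exists_Ioo_subset.1 (hIoo.and (hcol.and hJ))
  have hsub : Ioo a T ⊆ Ico 0 T := fun t ht => Ioo_subset_Ico_self (ha ht).1
  obtain ⟨Λ, hΛ⟩ := exists_lipschitzOnWith_fluxMomentum h hδ hb hconf (hz.mono hsub) isOpen_Ioo
    ordConnected_Ioo (fun t ht => (ha ht).2.1) (fun t ht => (ha ht).2.2.1)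
  obtain ⟨g, hg, hgΛ⟩ := hΛ.extend_real
  obtain ⟨R, hR⟩ := (hg.isBounded_image (Metric.isBounded_Ioo a T)).exists_norm_le
  rw [← hgΛ.image_eq] at hR
  have hinf : ∀ᶠ t in 𝓝[<] T,
      R + 2 * ‖(z 0).2‖ < |meanFlux b γ L δ (tubularCoord γ L δ (z t).1).1| :=
    ((hconf.tendsto_abs_meanFlux h.length_pos).comp hn).eventually_gt_atTop _
  obtain ⟨t, ht, htI⟩ := (hinf.and (Ioo_mem_nhdsLT haT)).exists
  obtain ⟨hJ₁, hJ₂⟩ := (ha htI).2.2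
  refine ht.not_ge ((abs_meanFlux_le h (abs_le.2 ⟨by linarith, hJ₂⟩)).trans ?_)
  rw [norm_velocity_eq hz ordConnected_Ico ⟨le_rfl, hT⟩ (hsub htI)]
  exact add_le_add_left (hR _ (mem_image_of_mem _ htI)) _

end Motion

end Flux

/-! ### Completeness -/

section Completeness

variable {Ω : Set Plane} {b : Plane → ℝ}

theorem lipschitzOnWith_position {U : Set (Plane × Plane)} {I : Set ℝ} {z : ℝ → Plane × Plane}
    (hz : IsIntegralCurveIn (lorentzField b) U I z) (hI : I.OrdConnected) {s : ℝ} (hs : s ∈ I) :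
    LipschitzOnWith ‖(z s).2‖₊ (fun t => (z t).1) I :=
  hI.convex.lipschitzOnWith_of_nnnorm_hasDerivWithin_le
    (fun _ ht => hasDerivWithinAt_position hz ht)
    fun _ ht => (norm_velocity_eq hz hI hs ht).le

theorem exists_isIntegralCurveIn_lorentzField_Ici (hΩ : IsOpen Ω) (hb : LocallyLipschitzOn Ω b)
    (hno : ∀ T > 0, ∀ z : ℝ → Plane × Plane,
      IsIntegralCurveIn (lorentzField b) (Ω ×ˢ univ) (Ico 0 T) z →
      ∀ p ∈ frontier Ω, ¬ Tendsto (fun t => (z t).1) (𝓝[<] T) (𝓝 p))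
    {q₀ : Plane} (hq₀ : q₀ ∈ Ω) (v₀ : Plane) :
    ∃ z : ℝ → Plane × Plane, z 0 = (q₀, v₀) ∧
      IsIntegralCurveIn (lorentzField b) (Ω ×ˢ univ) (Ici 0) z := by
  refine exists_isIntegralCurveIn_Ici (hΩ.prod isOpen_univ) (locallyLipschitzOn_lorentzField hb)
    ⟨hq₀, mem_univ _⟩ fun T hT z _ hz => ?_
  have h0 : (0 : ℝ) ∈ Ico 0 T := ⟨le_rfl, hT⟩
  have hIco : ∀ᶠ t in 𝓝[<] T, t ∈ Ico 0 T :=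
    mem_of_superset (Ioo_mem_nhdsLT hT) Ioo_subset_Ico_self
  obtain ⟨q₁, hq₁⟩ : ∃ q₁, Tendsto (fun t => (z t).1) (𝓝[<] T) (𝓝 q₁) :=
    CompleteSpace.complete ((cauchy_nhds.mono nhdsWithin_le_nhds).map_of_le
      (lipschitzOnWith_position hz ordConnected_Ico h0).uniformContinuousOn
      (le_principal_iff.2 hIco))
  have hq₁Ω : q₁ ∈ Ω := by
    by_contra hn
    exact hno T hT z hz q₁ (hΩ.frontier_eq ▸
      ⟨mem_closure_of_tendsto hq₁ (hIco.mono fun t ht => (hz.mapsTo ht).1), hn⟩) hq₁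
  obtain ⟨v₁, -, hv₁⟩ := (isCompact_closedBall (0 : Plane) ‖(z 0).2‖).exists_mapClusterPt
    (u := fun t => (z t).2) (f := 𝓝[<] T) (le_principal_iff.2 <| mem_map.2 <|
      hIco.mono fun t ht => mem_closedBall_zero_iff.2
        (norm_velocity_eq hz ordConnected_Ico h0 ht).le)
  obtain ⟨G, hG, hGv⟩ := mapClusterPt_iff_ultrafilter.1 hv₁
  exact ⟨(q₁, v₁), ⟨hq₁Ω, mem_univ _⟩,
    mapClusterPt_iff_ultrafilter.2 ⟨G, hG, (hq₁.mono_left hG).prodMk_nhds hGv⟩⟩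

theorem exists_isIntegralCurveIn_lorentzField_univ {q₀ v₀ : Plane}
    (h : ∃ z : ℝ → Plane × Plane, z 0 = (q₀, v₀) ∧
      IsIntegralCurveIn (lorentzField b) (Ω ×ˢ univ) (Ici 0) z)
    (hneg : ∃ z : ℝ → Plane × Plane, z 0 = (q₀, -v₀) ∧
      IsIntegralCurveIn (lorentzField (-b)) (Ω ×ˢ univ) (Ici 0) z) :
    ∃ z : ℝ → Plane × Plane, z 0 = (q₀, v₀) ∧
      IsIntegralCurveIn (lorentzField b) (Ω ×ˢ univ) univ z := by
  obtain ⟨α, hα0, hα⟩ := h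
  obtain ⟨β, hβ0, hβ⟩ := hneg
  have hpast := isIntegralCurveIn_lorentzField_comp_neg hβ
  rw [neg_Ici, neg_zero] at hpast
  have hinit : ((β (-0)).1, -(β (-0)).2) = (q₀, v₀) := by rw [neg_zero, hβ0, neg_neg]
  refine ⟨_, (if_pos le_rfl).trans hinit, IsIntegralCurveIn.glue (c := 0)
    (hpast.mono inter_subset_right) (hα.mono inter_subset_right) (hinit.trans hα0.symm)⟩

theorem not_tendsto_frontier (hb : ContinuousOn b Ω) {γ : Set Plane → ℝ → Plane}
    {L δ : Set Plane → ℝ}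
    (hγ : ∀ C, IsBoundaryComponent Ω C → IsArcLengthParam C (γ C) (L C))
    (hδ : ∀ C, IsBoundaryComponent Ω C → IsTubularWidth Ω C (γ C) (L C) (δ C))
    (hconf : ∀ C, IsBoundaryComponent Ω C → IsConfining b (γ C) (L C) (δ C))
    {T : ℝ} (hT : 0 < T) {z : ℝ → Plane × Plane}
    (hz : IsIntegralCurveIn (lorentzField b) (Ω ×ˢ univ) (Ico 0 T) z)
    {p : Plane} (hp : p ∈ frontier Ω) : ¬ Tendsto (fun t => (z t).1) (𝓝[<] T) (𝓝 p) := by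
  have hC : IsBoundaryComponent Ω (connectedComponentIn (frontier Ω) p) := ⟨p, hp, rfl⟩
  exact not_tendsto_boundary (hγ _ hC) (hδ _ hC) hb (hconf _ hC) hT hz
    (mem_connectedComponentIn hp)

end Completeness

end MagneticConfinement

open MagneticConfinement in
theorem theorem2p1_general (Ω : Set Plane) (hΩ : IsOpen Ω)
    (b : Plane → ℝ) (hb : LocallyLipschitzOn Ω b)
    (A : Plane → Plane) (hA : IsVectorPotential Ω A b)
    (γ : Set Plane → ℝ → Plane) (L δ : Set Plane → ℝ)
    (hγ : ∀ C, IsBoundaryComponent Ω C → IsArcLengthParam C (γ C) (L C))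
    (hδ : ∀ C, IsBoundaryComponent Ω C → IsTubularWidth Ω C (γ C) (L C) (δ C))
    (hconf : ∀ C, IsBoundaryComponent Ω C → IsConfining b (γ C) (L C) (δ C)) :
    (∀ q₀ ∈ Ω, ∀ p₀ : Plane,
      ∃! z : ℝ → Plane × Plane, z 0 = (q₀, p₀) ∧ IsTrajectoryOn Ω A univ z) ∧
    (∀ T : ℝ, 0 < T → ∀ z : ℝ → Plane × Plane, IsTrajectoryOn Ω A (Ico 0 T) z →
      ∀ x ∈ frontier Ω, ¬ Tendsto (fun t => (z t).1) (𝓝[<] T) (𝓝 x)) := by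
  refine ⟨fun q₀ hq₀ p₀ => ?_, fun T hT z hz x hx =>
    not_tendsto_frontier hb.continuousOn hγ hδ hconf hT (hA.isIntegralCurveIn hΩ hz) hx⟩
  have hfuture := exists_isIntegralCurveIn_lorentzField_Ici hΩ hb
    (fun T hT z hz x => not_tendsto_frontier hb.continuousOn hγ hδ hconf hT hz) hq₀ (p₀ - A q₀)
  have hpast := exists_isIntegralCurveIn_lorentzField_Ici hΩ hb.neg
    (fun T hT z hz x => not_tendsto_frontier hb.neg.continuousOn hγ hδ
      (fun C hC => (hconf C hC).neg) hT hz) hq₀ (-(p₀ - A q₀))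
  obtain ⟨z, hz0, hz⟩ := exists_isIntegralCurveIn_lorentzField_univ hfuture hpast
  refine ⟨_, ⟨by simp [hz0], hA.isTrajectoryOn hΩ hz⟩, fun w hw => funext fun t => ?_⟩
  have heq := (hA.isIntegralCurveIn hΩ hw.2).eqOn (locallyLipschitzOn_lorentzField hb) hz
    ordConnected_univ (mem_univ 0) (by simp [hw.1, hz0]) (mem_univ t)
  simp [← heq]

open MagneticConfinement in
theorem theorem2p1 (Ω : Set Plane) (hΩ : IsOpen Ω) (hΩb : Bornology.IsBounded Ω)
    (b : Plane → ℝ) (hb : LocallyLipschitzOn Ω b)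
    (A : Plane → Plane) (hA : IsVectorPotential Ω A b)
    (γ : Set Plane → ℝ → Plane) (L δ : Set Plane → ℝ)
    (hγ : ∀ C, IsBoundaryComponent Ω C → IsArcLengthParam C (γ C) (L C))
    (hδ : ∀ C, IsBoundaryComponent Ω C → IsTubularWidth Ω C (γ C) (L C) (δ C))
    (hlim : ∀ C, IsBoundaryComponent Ω C →
      Tendsto (fun n : ℝ => |∫ η in n..(δ C), ∫ ξ in (0 : ℝ)..(L C), tubularField b (γ C) η ξ|)
        (𝓝[>] 0) atTop)
    (hbdd : ∀ C, IsBoundaryComponent Ω C → ∃ M : ℝ, 0 ≤ M ∧ ∀ n ∈ Ioo 0 (δ C), ∀ s : ℝ,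
      |tubularField b (γ C) n s
        - 1 / L C * ∫ ξ in (0 : ℝ)..(L C), tubularField b (γ C) n ξ| ≤ M) :
    (∀ q₀ ∈ Ω, ∀ p₀ : Plane,
      ∃! z : ℝ → Plane × Plane, z 0 = (q₀, p₀) ∧ IsTrajectoryOn Ω A univ z) ∧
    (∀ T : ℝ, 0 < T → ∀ z : ℝ → Plane × Plane, IsTrajectoryOn Ω A (Ico 0 T) z →
      ∀ x ∈ frontier Ω, ¬ Tendsto (fun t => (z t).1) (𝓝[<] T) (𝓝 x)) :=
  theorem2p1_general Ω hΩ b hb A hA γ L δ hγ hδ fun C hC =>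
    ⟨hlim C hC, (hbdd C hC).imp fun _ hM => hM.2⟩
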